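/- **Setting.** A log is a finite sequence of transactions; $L$ extends $L'$ if $L'$ is a prefix of $L$, and two logs are consistent if one extends the other. A stake function assigns to each log $L$ and identifier $\mathit{id}$ a stake $S(L,\mathit{id})\ge 0$, finitely many of them positive, with $\sum_{\mathit{id}}S(L,\mathit{id})=\mathbb T>0$ for every $L$. Let $0\le\rho<1/2$. Each process holds a set of identifiers, these sets are pairwise disjoint, and a static adversary corrupts a set of processes, which then behave arbitrarily but cannot forge signatures of correct processes. The network is partially synchronous with delay bound $\Delta\ge1$ and an unknown global stabilisation time $\mathrm{GST}$; messages are disseminated to all processes; correct processes may be waiting (do nothing) at timeslots before $\mathrm{GST}$. A protocol is a state machine (started with a genesis log, which is its initial log) that at each timeslot receives sets of messages and transactions, changes state and sends messages; its state determines the current log $\mathsf{log}(p,\tau)$. An execution is *consistent* if (1) $\mathsf{log}(p,\tau_2)$ extends $\mathsf{log}(p,\tau_1)$ for every correct $p$ and $\tau_1<\tau_2$, and (2) $\mathsf{log}(p,\tau)$ and $\mathsf{log}(q,\tau)$ are consistent for all correct $p,q$ and all $\tau$. *Permissioned setting*: the processes are exactly the holders of the identifiers with positive stake in the genesis log $g$,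 they are always active, and the adversary is $\rho$-bounded if faulty processes hold at most $\rho\mathbb T$ of the stake $S(g,\cdot)$. *Quasi-permissionless setting*: any (possibly infinite) set of processes, which may be inactive, but the correct holders of positive stake in the log of an active correct process are active; every identifier with positive stake in a log $L$ such that $L$ extends $g$ and some $\mathsf{log}(p,\tau)$ with $p$ correct extends $L$ is held by a process; the adversary is $\rho$-bounded if faulty processes hold at most $\rho\mathbb T$ of the stake $S(L,\cdot)$ for every such $L$. **Epochs.** Fix a genesis log $g$. It has epoch $0$ and is completed. If $L\ne g$ extends $g$ and $L^-$ is $L$ without its last transaction, then $L$ has epoch $\mathrm{epoch}(L^-)+1$ and validators $\{\mathit{id}: S(L^-,\mathit{id})>0\}$ if $L^-$ is completed, and the epoch and validators of $L^-$ otherwise. For $e<\mathrm{epoch}(L)$ the epoch prefix of $L$ for $e$ is the completed prefix of $L$ of epoch $e$. $L\neq g$ can complete if the validators whose transaction $(\mathrm{FINISH},\mathrm{epoch}(L))$ occurs in $L$ have stake more than $\rho\mathbb T$, measured in the epoch prefix of $L$ for $\mathrm{epoch}(L)-1$; it is completed if it can complete and no strictly shorter prefix of the same epoch can. $L\ne g$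 is certified at a process that received signatures on $L$ from a set of validators of $L$ with stake at least $(1-\rho)\mathbb T$ in that same epoch prefix; $g$ is always certified. $L$ is fully certified if $L$ and all its epoch prefixes are certified. **Transformation.** In $\mathcal T(\mathcal P)$ each process starts with log $g$. Whenever it has received a fully-certified log that strictly extends its log, it adopts such a log (one per timeslot) and gossips the signatures that certify it. At the start, and whenever the adopted log $L$ is completed, it quits its current simulation and, if it holds an identifier with positive stake in $L$, starts simulating $\mathcal P$ with genesis log $L$; it also quits if the adopted log lies beyond the simulated epoch. Simulation messages are signed by an identifier with positive stake in $L$ and bound to $L$. Whenever it obtains from this simulation a new log of epoch $\mathrm{epoch}(L)+1$ (a prefix of the simulated log), it disseminates signatures on it by its validator identifiers. $\ell+\Delta$ steps after the start of the simulation it issues $(\mathrm{FINISH},\mathrm{epoch}(L)+1)$ for each of its identifiers with positive stake in $L$. **Theorem.** Suppose that $\mathcal P$ is consistent in the permissioned setting, that is, for every genesis log every execution against a $\rho$-bounded static adversary is consistent. Then, for every $\ell$, $\mathcal T(\mathcal P)$ is consistent in the quasi-permissionless setting against $\rho$-bounded static adversaries: in every execution, for every genesis log $g$, 1. no correct process ever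 rolls back its log: $\mathsf{log}(p,\tau_2)$ extends $\mathsf{log}(p,\tau_1)$ for every correct $p$ and $\tau_1<\tau_2$; 2. $\mathsf{log}(p,\tau)$ and $\mathsf{log}(q,\tau)$ are consistent for all correct $p,q$ and all $\tau$. Moreover, each epoch has at most one completed log among the logs $\mathsf{log}(p,\tau)$ of correct processes $p$. -/

import Mathlib

open scoped NNReal

/-! ## Transactions, logs, stake -/

/-- Transactions: arbitrary ordinary ones, and the transaction `(FINISH, e)` issued by `id`. -/
inductive Transaction (ID Base : Type) where
  | base (t : Base)
  | finish (id : ID) (e : ℕ)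

/-- A log is a finite sequence of transactions. -/
abbrev Log (Tx : Type) : Type := List Tx

/-- `L` extends `L'`, i.e. `L'` is a (not necessarily strict) prefix of `L`. -/
def Log.Extends {Tx : Type} (L L' : Log Tx) : Prop := L' <+: L

/-- Two logs are consistent when one of them extends the other. -/
def Log.Consistent {Tx : Type} (L₁ L₂ : Log Tx) : Prop :=
  Log.Extends L₁ L₂ ∨ Log.Extends L₂ L₁

/-- The stake function `S(L, id)`; the total stake is the same for all logs. -/
structure StakeFunction (ID Tx : Type) where
  stake : Log Tx → ID →₀ ℝ≥0
  total : ℝ≥0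
  total_pos : 0 < total
  sum_stake : ∀ L, ∑ id ∈ (stake L).support, stake L id = total

namespace StakeFunction

variable {ID Tx : Type} (S : StakeFunction ID Tx)

/-- The identifiers with positive stake after the log `L`. -/
def currentIds (L : Log Tx) : Finset ID := (S.stake L).support

theorem mem_currentIds (L : Log Tx) (id : ID) : id ∈ S.currentIds L ↔ 0 < S.stake L id := by
  simp [currentIds, pos_iff_ne_zero]

open Classical in
/-- The stake that the identifiers in `A` hold together after the log `L`. -/
noncomputable def stakeOf (L : Log Tx) (A : Set ID) : ℝ :=
  ∑ id ∈ (S.currentIds L).filter (fun id => id ∈ A), (S.stake L id : ℝ)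

end StakeFunction

/-! ## Protocols and their executions in the partially synchronous model -/

/-- A message-passing protocol.  Messages are disseminated to all processes.  `init g I` is the
initial state of a process that holds the identifiers `I`, for the genesis log `g`.
`step s M X` is the set of possible results (new state, messages sent) of a timeslot that a process
begins in state `s` and in which it receives the messages `M` and the transactions `X` (a singleton
if the protocol is deterministic).  `sigs m` is the set of the
(idealised) signatures, each a pair of a signer and a signed content, that `m` contains. -/
structure Protocol (ID Tx : Type) where
  State : Type
  Msg : Type
  Content : Type
  sigs : Msg → Set (ID × Content)
  init : Log Tx → Set ID → State
  step : State → Set Msg → Set Tx → Set (State × Set Msg)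
  step_nonempty : ∀ s M X, (step s M X).Nonempty
  log : State → Log Tx
  log_init : ∀ g I, log (init g I) = g

/-- Executions of a protocol with genesis log `g` by the processes in `Proc`, against a static
adversary, in the partially synchronous model with delay bound `Δ`. -/
structure Execution {ID Tx : Type} (P : Protocol ID Tx) (g : Log Tx) (Δ : ℕ) (Proc : Type) where
  /-- The identifiers held by a process. -/
  ids : Proc → Set ID
  ids_disjoint : ∀ p q id, id ∈ ids p → id ∈ ids q → p = q
  /-- The processes corrupted by the adversary. -/
  faulty : Set Proc
  GST : ℕ
  active : Proc → ℕ → Prop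
  waiting : Proc → ℕ → Prop
  /-- `state p k` is the state of `p` at the beginning of timeslot `k`. -/
  state : Proc → ℕ → P.State
  received : Proc → ℕ → Set P.Msg
  receivedTx : Proc → ℕ → Set Tx
  sent : Proc → ℕ → Set P.Msg
  state_zero : ∀ p, p ∉ faulty → state p 0 = P.init g (ids p)
  /-- A correct process that is active and not waiting follows the protocol. -/
  state_step : ∀ p, p ∉ faulty → ∀ k, active p k → ¬ waiting p k →
    (state p (k + 1), sent p k) ∈ P.step (state p k) (received p k) (receivedTx p k)
  /-- A correct process that is inactive or waiting does nothing. -/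
  state_idle : ∀ p, p ∉ faulty → ∀ k, (¬ active p k ∨ waiting p k) →
    state p (k + 1) = state p k ∧ sent p k = ∅ ∧ received p k = ∅
  /-- Correct processes wait only before the global stabilisation time. -/
  waiting_lt : ∀ p, p ∉ faulty → ∀ k, waiting p k → k < GST
  /-- Only messages that were sent before are received. -/
  received_sent : ∀ p, p ∉ faulty → ∀ k, ∀ m ∈ received p k, ∃ q j, j < k ∧ m ∈ sent q j
  /-- A message sent by a correct process in timeslot `j` is delivered by `max j GST + Δ`, or as
  soon afterwards as the recipient takes a step. -/
  delivered : ∀ q, q ∉ faulty → ∀ j, ∀ m ∈ sent q j, ∀ p, p ∉ faulty →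
    ∀ k, max j GST + Δ ≤ k → active p k → ¬ waiting p k → ∃ i, i ≤ k ∧ m ∈ received p i
  /-- Faulty processes may send any messages, but cannot forge signatures of correct processes:
  these can only be copied from messages that correct processes sent in earlier timeslots. -/
  unforgeable : ∀ f, f ∈ faulty → ∀ j, ∀ m ∈ sent f j, ∀ id c, (id, c) ∈ P.sigs m →
    (∃ p, p ∉ faulty ∧ id ∈ ids p) →
      ∃ q, q ∉ faulty ∧ ∃ i, i < j ∧ ∃ m' ∈ sent q i, (id, c) ∈ P.sigs m'

namespace Execution

variable {ID Tx Proc : Type} {P : Protocol ID Tx} {g : Log Tx} {Δ : ℕ}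

/-- The log of process `p` at timeslot `k`. -/
def log (E : Execution P g Δ Proc) (p : Proc) (k : ℕ) : Log Tx := P.log (E.state p k)

/-- No correct process ever rolls back its log. -/
def NoRollback (E : Execution P g Δ Proc) : Prop :=
  ∀ p, p ∉ E.faulty → ∀ k₁ k₂, k₁ < k₂ → Log.Extends (E.log p k₂) (E.log p k₁)

/-- The logs of two correct processes at the same timeslot are consistent. -/
def NoDivergence (E : Execution P g Δ Proc) : Prop :=
  ∀ p, p ∉ E.faulty → ∀ q, q ∉ E.faulty → ∀ k, Log.Consistent (E.log p k) (E.log q k)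

/-- The identifiers held by faulty processes. -/
def faultyIds (E : Execution P g Δ Proc) : Set ID := {id | ∃ p ∈ E.faulty, id ∈ E.ids p}

/-- The permissioned setting: the processes are exactly the holders of the identifiers with
positive stake in the genesis log, and they are always active. -/
structure Permissioned (E : Execution P g Δ Proc) (S : StakeFunction ID Tx) : Prop where
  participates : ∀ p, ∃ id ∈ E.ids p, 0 < S.stake g id
  held : ∀ id, 0 < S.stake g id → ∃ p, id ∈ E.ids p
  active : ∀ p k, E.active p k

/-- In the permissioned setting, a `ρ`-bounded adversary controls at most a fraction `ρ` of the
stake in the genesis log. -/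
def PermissionedBounded (E : Execution P g Δ Proc) (S : StakeFunction ID Tx) (ρ : ℝ) : Prop :=
  S.stakeOf g E.faultyIds ≤ ρ * S.total

/-- The quasi-permissionless setting: the number of processes is arbitrary (possibly infinite),
they may be inactive, but at every timeslot the correct processes that hold
stake according to the log of an active correct process are active. -/
structure QuasiPermissionless (E : Execution P g Δ Proc) (S : StakeFunction ID Tx) : Prop where
  held : ∀ q, q ∉ E.faulty → ∀ k L, Log.Extends (E.log q k) L → Log.Extends L g →
    ∀ id, 0 < S.stake L id → ∃ p, id ∈ E.ids p
  active : ∀ q, q ∉ E.faulty → ∀ k, E.active q k → ∀ p, p ∉ E.faulty → ∀ id ∈ E.ids p,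
    0 < S.stake (E.log q k) id → E.active p k

/-- In the quasi-permissionless setting, a `ρ`-bounded adversary controls at most a fraction `ρ`
of the stake in every log that extends the genesis log and is extended by the log of a correct
process. -/
def QuasiPermissionlessBounded (E : Execution P g Δ Proc) (S : StakeFunction ID Tx) (ρ : ℝ) :
    Prop :=
  ∀ p, p ∉ E.faulty → ∀ k L, Log.Extends (E.log p k) L → Log.Extends L g →
    S.stakeOf L E.faultyIds ≤ ρ * S.total

end Execution

/-- `P` is consistent in the permissioned setting (for every genesis log) against `ρ`-bounded
static adversaries. -/
def PermissionedConsistent {ID Tx : Type} (P : Protocol ID Tx) (S : StakeFunction ID Tx)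
    (ρ : ℝ) (Δ : ℕ) : Prop :=
  ∀ (Proc : Type) (g : Log Tx) (E : Execution P g Δ Proc),
    E.Permissioned S → E.PermissionedBounded S ρ → E.NoRollback ∧ E.NoDivergence

/-! ## Epochs -/

section Epochs

variable {ID Base : Type}

/-- The data attached to a log by the simultaneous recursion that defines epochs. -/
structure EpochInfo (ID Base : Type) where
  epoch : ℕ
  validators : Finset ID
  /-- the epoch prefix for the preceding epoch (the genesis log, for the genesis log) -/
  prev : Log (Transaction ID Base)
  canComplete : Prop
  /-- some strictly shorter log of the same epoch can complete -/
  earlier : Prop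
  completed : Prop

open Classical in
/-- The simultaneous recursion.  The last argument lists the transactions after the genesis log
`g`, the latest one first. -/
noncomputable def epochInfo (S : StakeFunction ID (Transaction ID Base)) (ρ : ℝ)
    (g : Log (Transaction ID Base)) : List (Transaction ID Base) → EpochInfo ID Base
  | [] => ⟨0, ∅, g, False, False, True⟩
  | t :: r =>
    let pre := epochInfo S ρ g r
    let L := g ++ (t :: r).reverse
    let epoch := if pre.completed then pre.epoch + 1 else pre.epoch
    let validators := if pre.completed then S.currentIds (g ++ r.reverse) else pre.validators
    let prev := if pre.completed then g ++ r.reverse else pre.prev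
    let finishers := validators.filter (fun id => Transaction.finish id epoch ∈ L)
    let canComplete := ρ * S.total < ∑ id ∈ finishers, (S.stake prev id : ℝ)
    let earlier := ¬ pre.completed ∧ (pre.canComplete ∨ pre.earlier)
    ⟨epoch, validators, prev, canComplete, earlier, canComplete ∧ ¬ earlier⟩

variable (S : StakeFunction ID (Transaction ID Base)) (ρ : ℝ) (g : Log (Transaction ID Base))

/-- The data of the log `L` (meaningful when `L` extends the genesis log `g`). -/
noncomputable def logInfo (L : Log (Transaction ID Base)) : EpochInfo ID Base :=
  epochInfo S ρ g (L.drop g.length).reverse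

/-- The epoch of a log. -/
noncomputable def logEpoch (L : Log (Transaction ID Base)) : ℕ := (logInfo S ρ g L).epoch

/-- The validators of a log other than the genesis log. -/
noncomputable def logValidators (L : Log (Transaction ID Base)) : Finset ID :=
  (logInfo S ρ g L).validators

/-- The epoch prefix of a log other than the genesis log for the epoch that precedes its own one
(see `logPrev_isEpochPrefix`). -/
noncomputable def logPrev (L : Log (Transaction ID Base)) : Log (Transaction ID Base) :=
  (logInfo S ρ g L).prev

/-- A log other than the genesis log can complete (see `logCanComplete_iff`). -/
def LogCanComplete (L : Log (Transaction ID Base)) : Prop := (logInfo S ρ g L).canComplete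

/-- A log is completed (see `logCompleted_iff`). -/
def LogCompleted (L : Log (Transaction ID Base)) : Prop := (logInfo S ρ g L).completed

/-- `L'` is the epoch prefix of `L` for the epoch `e`. -/
def IsEpochPrefix (L : Log (Transaction ID Base)) (e : ℕ) (L' : Log (Transaction ID Base)) :
    Prop :=
  e < logEpoch S ρ g L ∧ Log.Extends L L' ∧ Log.Extends L' g ∧
    logEpoch S ρ g L' = e ∧ LogCompleted S ρ g L'

/-- `L` is certified by the set `V` of received signatures on logs. -/
def Certified (V : Set (ID × Log (Transaction ID Base))) (L : Log (Transaction ID Base)) : Prop :=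
  L = g ∨ (Log.Extends L g ∧ ∃ I : Finset ID, I ⊆ logValidators S ρ g L ∧
    (∀ id ∈ I, (id, L) ∈ V) ∧
      (1 - ρ) * S.total ≤ ∑ id ∈ I, (S.stake (logPrev S ρ g L) id : ℝ))

/-- `L` is fully certified: `L` and all its epoch prefixes are certified. -/
def FullyCertified (V : Set (ID × Log (Transaction ID Base))) (L : Log (Transaction ID Base)) :
    Prop :=
  Certified S ρ g V L ∧ ∀ e L', IsEpochPrefix S ρ g L e L' → Certified S ρ g V L'

/-! The defining equations of the recursion. -/

theorem logInfo_genesis : logInfo S ρ g g = ⟨0, ∅, g, False, False, True⟩ := by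
  simp [logInfo, epochInfo]

theorem logEpoch_genesis : logEpoch S ρ g g = 0 := by simp [logEpoch, logInfo_genesis]

theorem logCompleted_genesis : LogCompleted S ρ g g := by simp [LogCompleted, logInfo_genesis]

theorem logInfo_append (xs : List (Transaction ID Base)) :
    logInfo S ρ g (g ++ xs) = epochInfo S ρ g xs.reverse := by
  simp [logInfo]

open Classical in
theorem logEpoch_snoc (L : Log (Transaction ID Base)) (h : Log.Extends L g)
    (t : Transaction ID Base) :
    logEpoch S ρ g (L ++ [t]) =
      if LogCompleted S ρ g L then logEpoch S ρ g L + 1 else logEpoch S ρ g L := by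
  obtain ⟨xs, rfl⟩ := h
  rw [List.append_assoc]
  simp [logEpoch, LogCompleted, logInfo_append, epochInfo]

open Classical in
theorem logValidators_snoc (L : Log (Transaction ID Base)) (h : Log.Extends L g)
    (t : Transaction ID Base) :
    logValidators S ρ g (L ++ [t]) =
      if LogCompleted S ρ g L then S.currentIds L else logValidators S ρ g L := by
  obtain ⟨xs, rfl⟩ := h
  rw [List.append_assoc]
  simp [logValidators, LogCompleted, logInfo_append, epochInfo]

open Classical in
theorem logPrev_snoc (L : Log (Transaction ID Base)) (h : Log.Extends L g)
    (t : Transaction ID Base) :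
    logPrev S ρ g (L ++ [t]) =
      if LogCompleted S ρ g L then L else logPrev S ρ g L := by
  obtain ⟨xs, rfl⟩ := h
  rw [List.append_assoc]
  simp [logPrev, LogCompleted, logInfo_append, epochInfo]

theorem Log.extends_induction {C : (L : Log (Transaction ID Base)) → Log.Extends L g → Prop}
    (h0 : C g (List.prefix_refl g))
    (h1 : ∀ L t (h : Log.Extends L g), C L h → C (L ++ [t]) (h.trans ⟨[t], rfl⟩))
    (L : Log (Transaction ID Base)) (h : Log.Extends L g) : C L h := by
  obtain ⟨xs, rfl⟩ := h
  induction xs using List.reverseRecOn with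
  | nil => simpa using h0
  | append_singleton ys t ih =>
    have := h1 _ t ⟨ys, rfl⟩ ih
    simpa [← List.append_assoc] using this

open Classical in
theorem logCanComplete_iff (L : Log (Transaction ID Base)) (h : Log.Extends L g) (hne : L ≠ g) :
    LogCanComplete S ρ g L ↔ ρ * S.total <
      ∑ id ∈ (logValidators S ρ g L).filter
        (fun id => Transaction.finish id (logEpoch S ρ g L) ∈ L),
          (S.stake (logPrev S ρ g L) id : ℝ) := by
  obtain ⟨xs, rfl⟩ := h
  induction xs using List.reverseRecOn with
  | nil => simp at hne
  | append_singleton ys t ih =>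
    simp [LogCanComplete, logValidators, logEpoch, logPrev, logInfo_append, epochInfo]

theorem logEpoch_mono (L' L : Log (Transaction ID Base)) (h' : Log.Extends L' g)
    (h : Log.Extends L L') : logEpoch S ρ g L' ≤ logEpoch S ρ g L := by
  obtain ⟨xs, rfl⟩ := h
  induction xs using List.reverseRecOn with
  | nil => simp
  | append_singleton ys t ih =>
    rw [← List.append_assoc, logEpoch_snoc _ _ _ _ (h'.trans ⟨ys, rfl⟩)]
    split_ifs <;> omega

theorem logEpoch_lt (L' L : Log (Transaction ID Base)) (h' : Log.Extends L' g)
    (h : Log.Extends L L') (hne : L' ≠ L) (hc : LogCompleted S ρ g L') :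
    logEpoch S ρ g L' < logEpoch S ρ g L := by
  obtain ⟨xs, rfl⟩ := h
  cases xs with
  | nil => simp at hne
  | cons t ys =>
    have h1 : logEpoch S ρ g (L' ++ [t]) = logEpoch S ρ g L' + 1 := by
      rw [logEpoch_snoc _ _ _ _ h', if_pos hc]
    have h2 := logEpoch_mono S ρ g (L' ++ [t]) (L' ++ t :: ys) (h'.trans ⟨[t], rfl⟩)
      ⟨ys, by simp⟩
    omega

theorem logEarlier_iff (L : Log (Transaction ID Base)) (h : Log.Extends L g) :
    (logInfo S ρ g L).earlier ↔ ∃ L', Log.Extends L' g ∧ Log.Extends L L' ∧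
      L'.length < L.length ∧ logEpoch S ρ g L' = logEpoch S ρ g L ∧ LogCanComplete S ρ g L' := by
  induction L, h using Log.extends_induction with
  | h0 =>
    simp only [logInfo_genesis, false_iff]
    rintro ⟨L', h1, h2, h3, -⟩
    exact absurd h1.length_le (by omega)
  | h1 L t hL ih =>
    have e1 : (logInfo S ρ g (L ++ [t])).earlier ↔
        ¬ LogCompleted S ρ g L ∧ (LogCanComplete S ρ g L ∨ (logInfo S ρ g L).earlier) := by
      obtain ⟨xs, rfl⟩ := hL
      rw [List.append_assoc]
      simp [LogCompleted, LogCanComplete, logInfo_append, epochInfo]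
    rw [e1, ih]
    have split : ∀ L', Log.Extends (L ++ [t]) L' → L'.length < (L ++ [t]).length →
        Log.Extends L L' := by
      intro L' a b
      exact List.prefix_of_prefix_length_le a ⟨[t], rfl⟩ (by simp at b; omega)
    constructor
    · rintro ⟨hc, hcan | ⟨L', a, b, c, d, f⟩⟩
      · refine ⟨L, hL, ⟨[t], rfl⟩, by simp, ?_, hcan⟩
        rw [logEpoch_snoc _ _ _ _ hL, if_neg hc]
      · refine ⟨L', a, b.trans ⟨[t], rfl⟩, by simp; omega, ?_, f⟩
        rw [logEpoch_snoc _ _ _ _ hL, if_neg hc, d]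
    · rintro ⟨L', a, b, c, d, f⟩
      have b' := split L' b c
      have m := logEpoch_mono S ρ g L' L a b'
      rw [logEpoch_snoc _ _ _ _ hL] at d
      by_cases hc : LogCompleted S ρ g L
      · rw [if_pos hc] at d; omega
      · rw [if_neg hc] at d
        refine ⟨hc, ?_⟩
        by_cases hl : L' = L
        · left; rwa [← hl]
        · refine Or.inr ⟨L', a, b', ?_, d, f⟩
          have := b'.length_le
          rcases this.lt_or_eq with h | h
          · exact h
          · exact absurd (b'.eq_of_length h) hl

theorem logCompleted_iff (L : Log (Transaction ID Base)) (h : Log.Extends L g) (hne : L ≠ g) :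
    LogCompleted S ρ g L ↔ LogCanComplete S ρ g L ∧
      ¬ ∃ L', Log.Extends L' g ∧ Log.Extends L L' ∧ L'.length < L.length ∧
        logEpoch S ρ g L' = logEpoch S ρ g L ∧ LogCanComplete S ρ g L' := by
  rw [← logEarlier_iff _ _ _ _ h]
  obtain ⟨xs, rfl⟩ := h
  induction xs using List.reverseRecOn with
  | nil => simp at hne
  | append_singleton ys t ih =>
    simp [LogCompleted, LogCanComplete, logInfo_append, epochInfo]

theorem isEpochPrefix_unique (L : Log (Transaction ID Base)) (e : ℕ)
    (L₁ L₂ : Log (Transaction ID Base)) (h₁ : IsEpochPrefix S ρ g L e L₁)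
    (h₂ : IsEpochPrefix S ρ g L e L₂) : L₁ = L₂ := by
  obtain ⟨-, a1, b1, c1, d1⟩ := h₁
  obtain ⟨-, a2, b2, c2, d2⟩ := h₂
  by_contra hne
  rcases List.prefix_or_prefix_of_prefix a1 a2 with h | h
  · have := logEpoch_lt S ρ g L₁ L₂ b1 h hne d1; omega
  · have := logEpoch_lt S ρ g L₂ L₁ b2 h (Ne.symm hne) d2; omega

theorem exists_isEpochPrefix (L : Log (Transaction ID Base)) (h : Log.Extends L g) (e : ℕ)
    (he : e < logEpoch S ρ g L) : ∃ L', IsEpochPrefix S ρ g L e L' := by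
  induction L, h using Log.extends_induction with
  | h0 => simp [logEpoch_genesis] at he
  | h1 L t hL ih =>
    have he' := he
    rw [logEpoch_snoc _ _ _ _ hL] at he'
    by_cases hlt : e < logEpoch S ρ g L
    · obtain ⟨L', -, a, b⟩ := ih hlt
      exact ⟨L', he, a.trans ⟨[t], rfl⟩, b⟩
    · split_ifs at he' with hc
      · exact ⟨L, he, ⟨[t], rfl⟩, hL, by omega, hc⟩
      · exact absurd he' hlt

theorem logPrev_isEpochPrefix (L : Log (Transaction ID Base)) (h : Log.Extends L g)
    (hne : L ≠ g) : IsEpochPrefix S ρ g L (logEpoch S ρ g L - 1) (logPrev S ρ g L) := by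
  induction L, h using Log.extends_induction with
  | h0 => exact absurd rfl hne
  | h1 L t hL ih =>
    by_cases hc : LogCompleted S ρ g L
    · have e1 : logEpoch S ρ g (L ++ [t]) = logEpoch S ρ g L + 1 := by
        rw [logEpoch_snoc _ _ _ _ hL, if_pos hc]
      rw [logPrev_snoc _ _ _ _ hL, if_pos hc, e1]
      exact ⟨by omega, ⟨[t], rfl⟩, hL, by omega, hc⟩
    · have e1 : logEpoch S ρ g (L ++ [t]) = logEpoch S ρ g L := by
        rw [logEpoch_snoc _ _ _ _ hL, if_neg hc]
      rw [logPrev_snoc _ _ _ _ hL, if_neg hc, e1]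
      have hg : L ≠ g := by rintro rfl; exact hc (logCompleted_genesis S ρ _)
      obtain ⟨a, b, c⟩ := ih hg
      exact ⟨by omega, b.trans ⟨[t], rfl⟩, c⟩

end Epochs

/-! ## The transformed protocol -/

section Transform

variable {ID Base : Type}

/-- Messages of the transformed protocol. -/
inductive TMsg (ID Base M : Type) where
  /-- The message `m` of the simulated protocol run with genesis log `g`, signed by `id`. -/
  | sim (id : ID) (g : Log (Transaction ID Base)) (m : M)
  /-- A signature by `id` on the log `L`. -/
  | vote (id : ID) (L : Log (Transaction ID Base))
  /-- Dissemination of a transaction. -/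
  | trans (t : Transaction ID Base)

/-- Contents that are signed in the transformed protocol.  All signatures of a simulated run are
bound to the genesis log of that run. -/
inductive TContent (ID Base M C : Type) where
  | simMsg (g : Log (Transaction ID Base)) (m : M)
  | simInner (g : Log (Transaction ID Base)) (c : C)
  | vote (L : Log (Transaction ID Base))
  | finish (e : ℕ)

/-- The signatures contained in a message of the transformed protocol. -/
def TMsg.sigs {M C : Type} (sg : M → Set (ID × C)) :
    TMsg ID Base M → Set (ID × TContent ID Base M C)
  | .sim id g m => {(id, .simMsg g m)} ∪ {x | ∃ id' c, (id', c) ∈ sg m ∧ x = (id', .simInner g c)}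
  | .vote id L => {(id, .vote L)}
  | .trans (.base _) => ∅
  | .trans (.finish id e) => {(id, .finish e)}

variable (P : Protocol ID (Transaction ID Base))

/-- A running simulation of `P`: its genesis log, the simulated state, and the number of steps
simulated so far. -/
structure Sim where
  genesis : Log (Transaction ID Base)
  st : P.State
  age : ℕ

/-- Local states of the transformed protocol. -/
structure TState where
  genesis : Log (Transaction ID Base)
  own : Set ID
  log : Log (Transaction ID Base)
  /-- all messages received so far -/
  inbox : Set (TMsg ID Base P.Msg)
  /-- all ordinary transactions received from the environment so far -/
  txs : Set (Transaction ID Base)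
  sim : Option (Sim P)

variable (S : StakeFunction ID (Transaction ID Base)) (ρ : ℝ)

open Classical in
/-- Starts a simulation of `P` whose genesis log is the completed log `L`, if the process holds an
identifier with positive stake in `L`. -/
noncomputable def startSim (own : Set ID) (L : Log (Transaction ID Base)) : Option (Sim P) :=
  if ∃ id ∈ own, 0 < S.stake L id then some ⟨L, P.init L own, 0⟩ else none

/-- The signatures on logs contained in a set of messages. -/
def votesIn {M : Type} (B : Set (TMsg ID Base M)) : Set (ID × Log (Transaction ID Base)) :=
  {x | TMsg.vote x.1 x.2 ∈ B}

/-- The fully-certified logs that strictly extend the current log, given the messages `B`. -/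
def candidates (s : TState P) (B : Set (TMsg ID Base P.Msg)) : Set (Log (Transaction ID Base)) :=
  {L | Log.Extends L s.log ∧ L ≠ s.log ∧ FullyCertified S ρ s.genesis (votesIn B) L}

/-- The process adopts a candidate, if there is one, and otherwise keeps its log. -/
def Adopts (s : TState P) (B : Set (TMsg ID Base P.Msg)) (L : Log (Transaction ID Base)) : Prop :=
  L ∈ candidates P S ρ s B ∨ (candidates P S ρ s B = ∅ ∧ L = s.log)

open Classical in
/-- The simulation after the log has become `L`.  When a completed log is adopted, the process
quits its simulation and starts a new one with that log as the genesis log.  When the adopted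
log is not completed, the simulation goes on provided that it is the one for the epoch of the
log. -/
noncomputable def nextSim (s : TState P) (L : Log (Transaction ID Base)) : Option (Sim P) :=
  if L = s.log then s.sim
  else if LogCompleted S ρ s.genesis L then startSim P S s.own L
  else match s.sim with
    | none => none
    | some σ =>
      if logEpoch S ρ s.genesis L = logEpoch S ρ s.genesis σ.genesis + 1 then some σ else none

/-- On adopting a new log, the process gossips the signatures that make it fully certified. -/
def gossip (s : TState P) (B : Set (TMsg ID Base P.Msg)) (L : Log (Transaction ID Base)) :
    Set (TMsg ID Base P.Msg) :=
  {x | L ≠ s.log ∧ ∃ id L', x = .vote id L' ∧ x ∈ B ∧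
    (L' = L ∨ ∃ e, IsEpochPrefix S ρ s.genesis L e L')}

/-- The ordinary transactions in a set of transactions. -/
def ordinary (X : Set (Transaction ID Base)) : Set (Transaction ID Base) :=
  {t | t ∈ X ∧ ∃ b, t = .base b}

/-- The messages, among those in `B`, for the simulation with genesis log `g`.  They have to be
signed by an identifier with positive stake in `g`. -/
def simMsgs (B : Set (TMsg ID Base P.Msg)) (g : Log (Transaction ID Base)) : Set P.Msg :=
  {m | ∃ id, 0 < S.stake g id ∧ TMsg.sim id g m ∈ B}

/-- The transactions disseminated in the messages `B`. -/
def transIn {M : Type} (B : Set (TMsg ID Base M)) : Set (Transaction ID Base) :=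
  {t | TMsg.trans t ∈ B}

/-- The messages caused by a step of the simulation `σ` to the state `st'` with output `out`, for a
process that holds the identifiers `own`, when `g` is the genesis log of the transformed protocol
and `D` is the epoch duration:
* the messages `out`, signed;
* signatures on all logs newly obtained from the simulation that belong to the simulated epoch;
* the transaction that asks for the end of the epoch, `D` steps after the start. -/
def simOutput (D : ℕ) (g : Log (Transaction ID Base)) (own : Set ID) (σ : Sim P) (st' : P.State)
    (out : Set P.Msg) : Set (TMsg ID Base P.Msg) :=
  {x | ∃ id ∈ own, 0 < S.stake σ.genesis id ∧ ∃ m ∈ out, x = .sim id σ.genesis m} ∪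
  {x | ∃ id ∈ own, ∃ L, x = .vote id L ∧ id ∈ logValidators S ρ g L ∧
    Log.Extends (P.log st') L ∧ ¬ Log.Extends (P.log σ.st) L ∧
    Log.Extends L σ.genesis ∧ L ≠ σ.genesis ∧
    logEpoch S ρ g L = logEpoch S ρ g σ.genesis + 1} ∪
  {x | σ.age = D ∧ ∃ id ∈ own, 0 < S.stake σ.genesis id ∧
    x = .trans (.finish id (logEpoch S ρ g σ.genesis + 1))}

open Classical in
/-- One timeslot of the transformed protocol, in which the messages `R` and the transactions `X`
are received: the log is updated, the simulation is replaced if necessary, and the simulated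
process takes a step.  A simulation that has just been started receives
everything that has arrived for it so far. -/
def TStep (D : ℕ) (s : TState P) (R : Set (TMsg ID Base P.Msg)) (X : Set (Transaction ID Base))
    (s' : TState P) (out : Set (TMsg ID Base P.Msg)) : Prop :=
  let B := s.inbox ∪ R
  let txs := s.txs ∪ ordinary X
  let relay := {x | ∃ t ∈ ordinary X, x = TMsg.trans t}
  ∃ L, Adopts P S ρ s B L ∧
    match nextSim P S ρ s L with
    | none => s' = ⟨s.genesis, s.own, L, B, txs, none⟩ ∧ out = relay ∪ gossip P S ρ s B L
    | some σ => ∃ y ∈ P.step σ.st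
          (simMsgs P S (if σ.age = 0 then B else R) σ.genesis)
          (if σ.age = 0 then txs ∪ transIn B else ordinary X ∪ transIn R),
        s' = ⟨s.genesis, s.own, L, B, txs, some ⟨σ.genesis, y.1, σ.age + 1⟩⟩ ∧
        out = relay ∪ gossip P S ρ s B L ∪ simOutput P S ρ D s.genesis s.own σ y.1 y.2

theorem tStep_nonempty (D : ℕ) (s : TState P) (R : Set (TMsg ID Base P.Msg))
    (X : Set (Transaction ID Base)) : ∃ s' out, TStep P S ρ D s R X s' out := by
  have hL : ∃ L, Adopts P S ρ s (s.inbox ∪ R) L := by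
    rcases Set.eq_empty_or_nonempty (candidates P S ρ s (s.inbox ∪ R)) with h | ⟨L, h⟩
    · exact ⟨s.log, Or.inr ⟨h, rfl⟩⟩
    · exact ⟨L, Or.inl h⟩
  obtain ⟨L, hL⟩ := hL
  cases h : nextSim P S ρ s L with
  | none => exact ⟨_, _, L, hL, by rw [h]; exact ⟨rfl, rfl⟩⟩
  | some σ =>
    obtain ⟨y, hy⟩ := P.step_nonempty σ.st
      (simMsgs P S (if σ.age = 0 then s.inbox ∪ R else R) σ.genesis)
      (if σ.age = 0 then (s.txs ∪ ordinary X) ∪ transIn (s.inbox ∪ R) else ordinary X ∪ transIn R)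
    refine ⟨⟨s.genesis, s.own, L, s.inbox ∪ R, s.txs ∪ ordinary X,
        some ⟨σ.genesis, y.1, σ.age + 1⟩⟩,
      {x | ∃ t ∈ ordinary X, x = TMsg.trans t} ∪ gossip P S ρ s (s.inbox ∪ R) L ∪
        simOutput P S ρ D s.genesis s.own σ y.1 y.2, L, hL, ?_⟩
    rw [h]
    exact ⟨y, hy, rfl, rfl⟩

/-- The transformed protocol `T(P)` with threshold `ρ` and epoch duration `ℓ + Δ`. -/
noncomputable def transform (ℓ Δ : ℕ) : Protocol ID (Transaction ID Base) where
  State := TState P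
  Msg := TMsg ID Base P.Msg
  Content := TContent ID Base P.Msg P.Content
  sigs := TMsg.sigs P.sigs
  init := fun g own => ⟨g, own, g, ∅, ∅, startSim P S own g⟩
  step := fun s R X => {y | TStep P S ρ (ℓ + Δ) s R X y.1 y.2}
  step_nonempty := fun s R X => by
    obtain ⟨s', out, h⟩ := tStep_nonempty P S ρ (ℓ + Δ) s R X
    exact ⟨(s', out), h⟩
  log := TState.log
  log_init := fun _ _ => rfl

end Transform

/-! Rollback is impossible because a correct process only ever replaces its log by an extension
(`tLog_mono`). For agreement, suppose that two correct processes hold inconsistent logs. By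
induction on `e` the two logs then share an epoch prefix for every `e`, which is absurd since a log
has a finite epoch (`log_consistent`).

In the inductive step let `L₀` be the common epoch prefix for `e`. Each of the two logs has a
certified prefix of epoch `e + 1` above `L₀` (`FullyCertified.exists_prefix`). As `ρ < 1/2`, a set
with a fraction `1 - ρ` of the stake in `L₀` contains an identifier of a correct process, and its
signature stems from a simulation of `P` with genesis log `L₀` at some correct process
(`vote_origin`, `exists_sim_of_certified`). Hence both certified prefixes are prefixes of simulated
logs, and it remains to see that the simulations with genesis log `L₀` agree
(`simState_consistent`).

These simulations are assembled into a permissioned execution of `P` among the holders of stake in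
`L₀`. They start at different times and are eventually abandoned, so taken as a whole they need not
satisfy the delivery bound. A disagreement, however, is visible in a finite run, and a finite run
can always be continued to an execution: `GST` is placed after it, and a process without a running
simulation counts as waiting (`Execution.exists_of_partial`). -/

/-! ## Extending finite runs to permissioned executions -/

section Extend

variable {ID Tx Proc : Type} (P : Protocol ID Tx)

open Classical in
/-- The states at time `k` and the messages sent before `k`, when the run given by `st` and `sent`
is followed up to time `K`, and from then on every message is delivered at once. -/
noncomputable def extendRun (faulty : Set Proc) (K : ℕ) (st : Proc → ℕ → P.State)
    (sent : Proc → ℕ → Set P.Msg) : ℕ → (Proc → P.State) × Set P.Msg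
  | 0 => (fun p => st p 0, ∅)
  | k + 1 =>
    let c := extendRun faulty K st sent k
    if k < K then (fun p => st p (k + 1), c.2 ∪ {m | ∃ p, m ∈ sent p k})
    else (fun p => (P.step_nonempty (c.1 p) c.2 ∅).some.1,
      c.2 ∪ {m | ∃ p, p ∉ faulty ∧ m ∈ (P.step_nonempty (c.1 p) c.2 ∅).some.2})

open Classical in
/-- The messages sent in the run `extendRun`. -/
noncomputable def extendSent (faulty : Set Proc) (K : ℕ) (st : Proc → ℕ → P.State)
    (sent : Proc → ℕ → Set P.Msg) (p : Proc) (k : ℕ) : Set P.Msg :=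
  let c := extendRun P faulty K st sent k
  if k < K then sent p k
  else if p ∈ faulty then ∅ else (P.step_nonempty (c.1 p) c.2 ∅).some.2

theorem extendRun_fst (faulty : Set Proc) (K : ℕ) (st : Proc → ℕ → P.State)
    (sent : Proc → ℕ → Set P.Msg) (k : ℕ) (hk : k ≤ K) (p : Proc) :
    (extendRun P faulty K st sent k).1 p = st p k := by
  cases k with
  | zero => rfl
  | succ k => simp [extendRun, if_pos (show k < K by omega)]

/-- The accumulated set is exactly what has been sent so far. Since it is what every process
receives from time `K` on, this gives both causality of reception and delivery. -/
theorem mem_extendRun_snd (faulty : Set Proc) (K : ℕ) (st : Proc → ℕ → P.State)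
    (sent : Proc → ℕ → Set P.Msg) (k : ℕ) (m : P.Msg) :
    m ∈ (extendRun P faulty K st sent k).2 ↔
      ∃ q j, j < k ∧ m ∈ extendSent P faulty K st sent q j := by
  induction k with
  | zero => simp [extendRun]
  | succ k ih =>
    have h : m ∈ (extendRun P faulty K st sent (k + 1)).2 ↔
        m ∈ (extendRun P faulty K st sent k).2 ∨ ∃ q, m ∈ extendSent P faulty K st sent q k := by
      by_cases hk : k < K
      · simp [extendRun, extendSent, hk]
      · simp only [extendRun, extendSent, hk, if_false, Set.mem_union, Set.mem_ofPred_eq]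
        refine or_congr Iff.rfl (exists_congr fun q => ?_)
        by_cases hq : q ∈ faulty <;> simp [hq]
    rw [h, ih]
    constructor
    · rintro (⟨q, j, hj, hm⟩ | ⟨q, hm⟩)
      · exact ⟨q, j, by omega, hm⟩
      · exact ⟨q, k, by omega, hm⟩
    · rintro ⟨q, j, hj, hm⟩
      rcases (Nat.lt_succ_iff.1 hj).lt_or_eq with h | rfl
      · exact Or.inl ⟨q, j, h, hm⟩
      · exact Or.inr ⟨q, hm⟩

open Classical in
/-- A finite run in which correct processes take steps or wait is the beginning of an execution
in which all processes are active. -/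
theorem Execution.exists_of_partial (g : Log Tx) {Δ : ℕ} (hΔ : 0 < Δ)
    (ids : Proc → Set ID) (hids : ∀ p q id, id ∈ ids p → id ∈ ids q → p = q)
    (faulty : Set Proc) (K : ℕ) (st : Proc → ℕ → P.State) (recv sent : Proc → ℕ → Set P.Msg)
    (h0 : ∀ p, p ∉ faulty → st p 0 = P.init g (ids p))
    (hstep : ∀ p, p ∉ faulty → ∀ k < K,
      (st p (k + 1) = st p k ∧ sent p k = ∅ ∧ recv p k = ∅) ∨
        ∃ X, (st p (k + 1), sent p k) ∈ P.step (st p k) (recv p k) X)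
    (hrecv : ∀ p, p ∉ faulty → ∀ k < K, ∀ m ∈ recv p k, ∃ q j, j < k ∧ m ∈ sent q j)
    (hunf : ∀ f, f ∈ faulty → ∀ j < K, ∀ m ∈ sent f j, ∀ id c, (id, c) ∈ P.sigs m →
      (∃ p, p ∉ faulty ∧ id ∈ ids p) →
        ∃ q, q ∉ faulty ∧ ∃ i, i < j ∧ ∃ m' ∈ sent q i, (id, c) ∈ P.sigs m') :
    ∃ E : Execution P g Δ Proc, E.ids = ids ∧ E.faulty = faulty ∧ (∀ p k, E.active p k) ∧
      ∀ p k, k ≤ K → E.state p k = st p k := by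
  have hlt : ∀ p k, k < K → extendSent P faulty K st sent p k = sent p k := fun p k hk => by
    simp [extendSent, hk]
  -- With `GST` at `K`, any waiting in the given run is legal and no delivery is due before `K + Δ`.
  -- A timeslot before `K` counts as waiting exactly when no protocol step explains it, so the two
  -- alternatives of `hstep` become exclusive.
  refine ⟨{ ids := ids, ids_disjoint := hids, faulty := faulty, GST := K
            active := fun _ _ => True
            waiting := fun p k => k < K ∧
              ¬ ∃ X, (st p (k + 1), sent p k) ∈ P.step (st p k) (recv p k) X
            state := fun p k => (extendRun P faulty K st sent k).1 p
            received := fun p k => if k < K then recv p k else (extendRun P faulty K st sent k).2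
            receivedTx := fun p k =>
              if h : k < K ∧ ∃ X, (st p (k + 1), sent p k) ∈ P.step (st p k) (recv p k) X
              then h.2.choose else ∅
            sent := extendSent P faulty K st sent
            state_zero := h0
            waiting_lt := fun p _ k h => h.1
            state_step := ?_
            state_idle := ?_
            received_sent := ?_
            delivered := ?_
            unforgeable := ?_ }, rfl, rfl, fun _ _ => trivial,
            fun p k hk => extendRun_fst P faulty K st sent k hk p⟩
  · intro p hp k _ hw
    by_cases hk : k < K
    · have hX := not_not.1 fun h => hw ⟨hk, h⟩
      rw [dif_pos ⟨hk, hX⟩, if_pos hk, hlt p k hk, extendRun_fst _ _ _ _ _ _ hk,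
        extendRun_fst _ _ _ _ _ _ hk.le]
      exact hX.choose_spec
    · rw [dif_neg (fun h => hk h.1), if_neg hk]
      simp only [extendRun, extendSent, hk, if_false, hp]
      exact (P.step_nonempty _ _ ∅).some_mem
  · rintro p hp k (h | ⟨hk, hX⟩)
    · exact absurd trivial h
    · rw [if_pos hk, hlt p k hk, extendRun_fst _ _ _ _ _ _ hk, extendRun_fst _ _ _ _ _ _ hk.le]
      exact (hstep p hp k hk).resolve_right hX
  · intro p hp k m hm
    by_cases hk : k < K
    · rw [if_pos hk] at hm
      obtain ⟨q, j, hj, hm⟩ := hrecv p hp k hk m hm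
      exact ⟨q, j, hj, by rwa [hlt q j (hj.trans hk)]⟩
    · rw [if_neg hk] at hm
      exact (mem_extendRun_snd _ _ _ _ _ _ _).1 hm
  · intro q _ j m hm p _ k hk _ _
    have h1 := le_max_left j K
    have h2 := le_max_right j K
    -- Timeslot `k` itself works: it is not before `K`, so everything sent earlier arrives, and `j <
    -- k` because `Δ` is positive.
    refine ⟨k, le_rfl, ?_⟩
    rw [if_neg (by omega)]
    exact (mem_extendRun_snd _ _ _ _ _ _ _).2 ⟨q, j, by omega, hm⟩
  · intro f hf j m hm id c hc hp
    by_cases hj : j < K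
    · rw [hlt f j hj] at hm
      obtain ⟨q, hq, i, hi, m', hm', hc'⟩ := hunf f hf j hj m hm id c hc hp
      exact ⟨q, hq, i, hi, m', by rwa [hlt q i (hi.trans hj)], hc'⟩
    -- Faulty processes are silent from `K` on, so they forge nothing there.
    · simp [extendSent, hj, hf] at hm

end Extend

/-! ## Correct processes of the transformed protocol -/

section Correct

variable {ID Base : Type}

theorem FullyCertified.mono {S : StakeFunction ID (Transaction ID Base)} {ρ : ℝ}
    {g L : Log (Transaction ID Base)} {V W : Set (ID × Log (Transaction ID Base))}
    (h : FullyCertified S ρ g V L) (hVW : V ⊆ W) : FullyCertified S ρ g W L := by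
  have key : ∀ L', Certified S ρ g V L' → Certified S ρ g W L' := by
    rintro L' (h | ⟨h1, I, h2, h3, h4⟩)
    · exact Or.inl h
    · exact Or.inr ⟨h1, I, h2, fun id hid => hVW (h3 id hid), h4⟩
  exact ⟨key _ h.1, fun e L' hL' => key _ (h.2 e L' hL')⟩

theorem Certified.extends {S : StakeFunction ID (Transaction ID Base)} {ρ : ℝ}
    {g L : Log (Transaction ID Base)} {V : Set (ID × Log (Transaction ID Base))}
    (h : Certified S ρ g V L) : Log.Extends L g := by
  rcases h with rfl | h
  · exact List.prefix_refl _
  · exact h.1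

theorem fullyCertified_genesis (S : StakeFunction ID (Transaction ID Base)) (ρ : ℝ)
    (g : Log (Transaction ID Base)) (V : Set (ID × Log (Transaction ID Base))) :
    FullyCertified S ρ g V g := by
  refine ⟨Or.inl rfl, fun e L' h => ?_⟩
  have := h.1
  simp [logEpoch_genesis] at this

/-- The signed contents of different kinds of messages are different, so the signature determines
the message. Unforgeability thereby yields that this very message was sent earlier by a correct
process. -/
theorem TMsg.eq_vote_of_mem_sigs {M C : Type} {sg : M → Set (ID × C)} {id : ID}
    {L : Log (Transaction ID Base)} {x : TMsg ID Base M}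
    (h : (id, TContent.vote L) ∈ TMsg.sigs sg x) : x = TMsg.vote id L := by
  cases x with
  | sim id' g' m => simp [TMsg.sigs] at h
  | vote id' L' => simp_all [TMsg.sigs]
  | trans t => cases t <;> simp [TMsg.sigs] at h

theorem TMsg.eq_sim_of_mem_sigs {M C : Type} {sg : M → Set (ID × C)} {id : ID}
    {L : Log (Transaction ID Base)} {m : M} {x : TMsg ID Base M}
    (h : (id, TContent.simMsg L m) ∈ TMsg.sigs sg x) : x = TMsg.sim id L m := by
  cases x with
  | sim id' g' m => simp_all [TMsg.sigs]
  | vote id' L' => simp [TMsg.sigs] at h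
  | trans t => cases t <;> simp [TMsg.sigs] at h

/-- Here the message is not determined, only its simulation: because inner signatures are bound to
`L`, they cannot be transplanted from one simulation to another. -/
theorem TMsg.exists_of_simInner_mem_sigs {M C : Type} {sg : M → Set (ID × C)} {id : ID}
    {L : Log (Transaction ID Base)} {c : C} {x : TMsg ID Base M}
    (h : (id, TContent.simInner L c) ∈ TMsg.sigs sg x) :
    ∃ id' m, x = TMsg.sim id' L m ∧ (id, c) ∈ sg m := by
  cases x with
  | sim id' g' m =>
    rcases h with h | ⟨a, b, h1, h2⟩
    · simp at h
    · simp only [Prod.mk.injEq, TContent.simInner.injEq] at h2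
      obtain ⟨rfl, rfl, rfl⟩ := h2
      exact ⟨_, _, rfl, h1⟩
  | vote id' L' => simp [TMsg.sigs] at h
  | trans t => cases t <;> simp [TMsg.sigs] at h

variable {P : Protocol ID (Transaction ID Base)}

theorem startSim_eq_some {S : StakeFunction ID (Transaction ID Base)} {own : Set ID}
    {L : Log (Transaction ID Base)} {σ : Sim P} (h : startSim P S own L = some σ) :
    σ = ⟨L, P.init L own, 0⟩ ∧ ∃ id ∈ own, 0 < S.stake L id := by
  unfold startSim at h
  split_ifs at h with hc
  exact ⟨(Option.some.inj h).symm, hc⟩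

variable {S : StakeFunction ID (Transaction ID Base)} {ρ : ℝ} {D : ℕ}
  {g : Log (Transaction ID Base)} {own : Set ID}

theorem nextSim_eq_some {s : TState P} {L : Log (Transaction ID Base)} {σ : Sim P}
    (h : nextSim P S ρ s L = some σ) :
    s.sim = some σ ∨ (σ = ⟨L, P.init L s.own, 0⟩ ∧ L ≠ s.log ∧ LogCompleted S ρ s.genesis L ∧
      ∃ id ∈ s.own, 0 < S.stake L id) := by
  unfold nextSim at h
  split_ifs at h with h1 h2
  · exact Or.inl h
  · obtain ⟨h3, h4⟩ := startSim_eq_some h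
    exact Or.inr ⟨h3, h1, h2, h4⟩
  · cases hs : s.sim with
    | none => simp [hs] at h
    | some τ =>
      simp only [hs] at h
      split_ifs at h
      exact Or.inl h

theorem Adopts.extends {s : TState P} {B : Set (TMsg ID Base P.Msg)}
    {L : Log (Transaction ID Base)} (h : Adopts P S ρ s B L) : Log.Extends L s.log := by
  rcases h with h | h
  · exact h.1
  · rw [h.2]; exact List.prefix_refl _

/-- The invariant of the state of a correct process that holds the identifiers `own`, when `g` is
the genesis log. -/
structure TState.WellFormed (S : StakeFunction ID (Transaction ID Base)) (ρ : ℝ)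
    (g : Log (Transaction ID Base)) (own : Set ID) (s : TState P) : Prop where
  genesis_eq : s.genesis = g
  own_eq : s.own = own
  certified : FullyCertified S ρ g (votesIn s.inbox) s.log
  sim : ∀ σ, s.sim = some σ → Log.Extends s.log σ.genesis ∧ Log.Extends σ.genesis g ∧
    LogCompleted S ρ g σ.genesis ∧ ∃ id ∈ own, 0 < S.stake σ.genesis id

theorem TState.wellFormed_init :
    TState.WellFormed S ρ g own (⟨g, own, g, ∅, ∅, startSim P S own g⟩ : TState P) where
  genesis_eq := rfl
  own_eq := rfl
  certified := fullyCertified_genesis S ρ g _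
  sim := fun σ hσ => by
    obtain ⟨rfl, h⟩ := startSim_eq_some hσ
    exact ⟨List.prefix_refl _, List.prefix_refl _, logCompleted_genesis S ρ g, h⟩

/-- The effect of a step on everything but the simulation. -/
theorem TStep.basic {s s' : TState P} {R : Set (TMsg ID Base P.Msg)}
    {X : Set (Transaction ID Base)} {out : Set (TMsg ID Base P.Msg)}
    (h : TStep P S ρ D s R X s' out) :
    s'.genesis = s.genesis ∧ s'.own = s.own ∧ s'.inbox = s.inbox ∪ R ∧
      Adopts P S ρ s (s.inbox ∪ R) s'.log ∧
      ∀ σ', s'.sim = some σ' → ∃ σ, nextSim P S ρ s s'.log = some σ ∧ σ'.genesis = σ.genesis := by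
  obtain ⟨L, hL, h⟩ := h
  cases hn : nextSim P S ρ s L with
  | none =>
    simp only [hn] at h
    obtain ⟨rfl, -⟩ := h
    exact ⟨rfl, rfl, rfl, hL, by simp⟩
  | some σ =>
    simp only [hn] at h
    obtain ⟨y, -, rfl, -⟩ := h
    refine ⟨rfl, rfl, rfl, hL, ?_⟩
    rintro σ' hσ'
    obtain rfl := Option.some.inj hσ'
    exact ⟨σ, hn, rfl⟩

/-- Certification persists because the inbox only grows, and the genesis log of the simulation
remains a prefix because the log only grows. -/
theorem TState.WellFormed.step {s s' : TState P} {R : Set (TMsg ID Base P.Msg)}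
    {X : Set (Transaction ID Base)} {out : Set (TMsg ID Base P.Msg)}
    (hs : s.WellFormed S ρ g own) (h : TStep P S ρ D s R X s' out) : s'.WellFormed S ρ g own := by
  obtain ⟨h1, h2, h3, h4, h5⟩ := h.basic
  have hcert : FullyCertified S ρ g (votesIn s'.inbox) s'.log := by
    rw [h3]
    rcases h4 with h4 | h4
    · have := h4.2.2
      rwa [hs.genesis_eq] at this
    · rw [h4.2]
      exact hs.certified.mono fun x hx => Or.inl hx
  refine ⟨h1.trans hs.genesis_eq, h2.trans hs.own_eq, hcert, ?_⟩
  intro σ' hσ'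
  obtain ⟨σ, hn, hg⟩ := h5 σ' hσ'
  rw [hg]
  rcases nextSim_eq_some hn with h6 | ⟨rfl, -, h7, h8⟩
  · obtain ⟨a, b⟩ := hs.sim σ h6
    exact ⟨a.trans h4.extends, b⟩
  · rw [hs.genesis_eq] at h7
    rw [hs.own_eq] at h8
    exact ⟨List.prefix_refl _, hcert.1.extends, h7, h8⟩

/-- The messages for a simulation and the signatures on logs that are sent in a step. -/
theorem TStep.sim_of_sent {s s' : TState P} {R : Set (TMsg ID Base P.Msg)}
    {X : Set (Transaction ID Base)} {out : Set (TMsg ID Base P.Msg)}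
    (h : TStep P S ρ D s R X s' out) {id : ID} {L₀ : Log (Transaction ID Base)} {m : P.Msg}
    (hm : TMsg.sim id L₀ m ∈ out) : ∃ σ', s'.sim = some σ' ∧ σ'.genesis = L₀ := by
  obtain ⟨L, hL, h⟩ := h
  cases hn : nextSim P S ρ s L with
  | none =>
    simp only [hn] at h
    obtain ⟨rfl, rfl⟩ := h
    simp [gossip] at hm
  | some σ =>
    simp only [hn] at h
    obtain ⟨y, -, rfl, rfl⟩ := h
    simp [gossip, simOutput] at hm
    exact ⟨_, rfl, hm.2.2.2.symm⟩

/-- The first alternative is gossip, which can be traced to an earlier sender; the second is a fresh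
signature. -/
theorem TStep.vote_of_sent {s s' : TState P} {R : Set (TMsg ID Base P.Msg)}
    {X : Set (Transaction ID Base)} {out : Set (TMsg ID Base P.Msg)}
    (h : TStep P S ρ D s R X s' out) {id : ID} {L : Log (Transaction ID Base)}
    (hm : TMsg.vote id L ∈ out) : TMsg.vote id L ∈ s'.inbox ∨
      ∃ σ', s'.sim = some σ' ∧ Log.Extends (P.log σ'.st) L ∧ Log.Extends L σ'.genesis ∧
        logEpoch S ρ s.genesis L = logEpoch S ρ s.genesis σ'.genesis + 1 := by
  obtain ⟨L', hL, h⟩ := h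
  cases hn : nextSim P S ρ s L' with
  | none =>
    simp only [hn] at h
    obtain ⟨rfl, rfl⟩ := h
    simp [gossip] at hm
    exact Or.inl hm.2.1
  | some σ =>
    simp only [hn] at h
    obtain ⟨y, -, rfl, rfl⟩ := h
    simp [gossip, simOutput] at hm
    rcases hm with hm | hm
    · exact Or.inl hm.2.1
    · exact Or.inr ⟨_, rfl, hm.2.2.1, hm.2.2.2.2.1, hm.2.2.2.2.2.2⟩

/-- A step in which a simulation is running is a step of the simulated protocol. -/
theorem TStep.sim_step {s s' : TState P} {R : Set (TMsg ID Base P.Msg)}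
    {X : Set (Transaction ID Base)} {out : Set (TMsg ID Base P.Msg)}
    (h : TStep P S ρ D s R X s' out) {σ' : Sim P} (hσ' : s'.sim = some σ') :
    ∃ σ, nextSim P S ρ s s'.log = some σ ∧ σ'.genesis = σ.genesis ∧
      ∃ M ⊆ simMsgs P S s'.inbox σ.genesis, ∃ Y out', (σ'.st, out') ∈ P.step σ.st M Y ∧
        ∀ id m, TMsg.sim id σ.genesis m ∈ out → m ∈ out' := by
  obtain ⟨L, hL, h⟩ := h
  cases hn : nextSim P S ρ s L with
  | none =>
    simp only [hn] at h
    obtain ⟨rfl, -⟩ := h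
    simp at hσ'
  | some σ =>
    simp only [hn] at h
    obtain ⟨y, hy, rfl, rfl⟩ := h
    obtain rfl := Option.some.inj hσ'
    refine ⟨σ, hn, rfl, _, ?_, _, y.2, hy, ?_⟩
    · rintro m ⟨id, h1, h2⟩
      refine ⟨id, h1, ?_⟩
      split_ifs at h2
      · exact h2
      · exact Or.inr h2
    · intro id m hm
      simp [gossip, simOutput] at hm
      exact hm.2.2

/-- The state of the simulation with genesis log `L₀`, along a sequence of states. -/
noncomputable def simTrace (L₀ : Log (Transaction ID Base)) (own : Set ID) (s : ℕ → TState P) :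
    ℕ → P.State
  | 0 => P.init L₀ own
  | k + 1 =>
    open Classical in
    match (s (k + 1)).sim with
    | none => simTrace L₀ own s k
    | some σ => if σ.genesis = L₀ then σ.st else simTrace L₀ own s k

theorem simTrace_eq {s : ℕ → TState P} (h0 : s 0 = ⟨g, own, g, ∅, ∅, startSim P S own g⟩)
    {k : ℕ} {σ : Sim P} (h : (s k).sim = some σ) : simTrace σ.genesis own s k = σ.st := by
  cases k with
  | zero =>
    rw [h0] at h
    obtain ⟨rfl, -⟩ := startSim_eq_some h
    rfl
  | succ k => simp [simTrace, h]

/-- Before the simulation starts and after it has been quit, its trace is frozen; this is what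
allows such timeslots to pass for waiting. -/
theorem simTrace_succ_of_ne {s : ℕ → TState P} {L₀ : Log (Transaction ID Base)} {k : ℕ}
    (h : ∀ σ, (s (k + 1)).sim = some σ → σ.genesis ≠ L₀) :
    simTrace L₀ own s (k + 1) = simTrace L₀ own s k := by
  cases hs : (s (k + 1)).sim with
  | none => simp [simTrace, hs]
  | some σ => simp [simTrace, hs, h σ hs]

theorem simTrace_of_ne {s : ℕ → TState P} {L₀ : Log (Transaction ID Base)} {k : ℕ}
    (h : ∀ j ≤ k, ∀ σ, (s j).sim = some σ → σ.genesis ≠ L₀) :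
    simTrace L₀ own s k = P.init L₀ own := by
  induction k with
  | zero => rfl
  | succ k ih => rw [simTrace_succ_of_ne (h _ le_rfl), ih fun j hj => h j (by omega)]

end Correct

/-! ## Executions of the transformed protocol -/

section Executions

variable {ID Base Proc : Type} {S : StakeFunction ID (Transaction ID Base)} {ρ : ℝ} {ℓ Δ : ℕ}
  {P : Protocol ID (Transaction ID Base)} {g : Log (Transaction ID Base)}
  (E : Execution (transform P S ρ ℓ Δ) g Δ Proc)

namespace Execution

/-- The states of a process of the transformed protocol. -/
def tState (p : Proc) (k : ℕ) : TState P := E.state p k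

/-- The messages received by a process of the transformed protocol. -/
def tReceived (p : Proc) (k : ℕ) : Set (TMsg ID Base P.Msg) := E.received p k

/-- The messages sent by a process of the transformed protocol. -/
def tSent (p : Proc) (k : ℕ) : Set (TMsg ID Base P.Msg) := E.sent p k

theorem tState_zero {p : Proc} (hp : p ∉ E.faulty) :
    E.tState p 0 = ⟨g, E.ids p, g, ∅, ∅, startSim P S (E.ids p) g⟩ := E.state_zero p hp

theorem tStep_or_idle {p : Proc} (hp : p ∉ E.faulty) (k : ℕ) :
    TStep P S ρ (ℓ + Δ) (E.tState p k) (E.tReceived p k) (E.receivedTx p k)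
        (E.tState p (k + 1)) (E.tSent p k) ∨
      (E.tState p (k + 1) = E.tState p k ∧ E.tSent p k = ∅) := by
  by_cases h : ¬ E.active p k ∨ E.waiting p k
  · obtain ⟨h1, h2, -⟩ := E.state_idle p hp k h
    exact Or.inr ⟨h1, h2⟩
  · push Not at h
    exact Or.inl (E.state_step p hp k h.1 h.2)

theorem tState_wellFormed {p : Proc} (hp : p ∉ E.faulty) (k : ℕ) :
    (E.tState p k).WellFormed S ρ g (E.ids p) := by
  induction k with
  | zero => rw [E.tState_zero hp]; exact TState.wellFormed_init
  | succ k ih =>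
    rcases E.tStep_or_idle hp k with h | h
    · exact ih.step h
    · rwa [h.1]

theorem received_of_mem_inbox {p : Proc} (hp : p ∉ E.faulty) {k : ℕ}
    {x : TMsg ID Base P.Msg} (hx : x ∈ (E.tState p k).inbox) :
    ∃ i < k, x ∈ E.tReceived p i := by
  induction k with
  | zero => rw [E.tState_zero hp] at hx; exact absurd hx (Set.notMem_empty x)
  | succ k ih =>
    rcases E.tStep_or_idle hp k with h | h
    · rw [h.basic.2.2.1] at hx
      rcases hx with hx | hx
      · obtain ⟨i, hi, hx⟩ := ih hx
        exact ⟨i, by omega, hx⟩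
      · exact ⟨k, by omega, hx⟩
    · rw [h.1] at hx
      obtain ⟨i, hi, hx⟩ := ih hx
      exact ⟨i, by omega, hx⟩

/-- The bound is strict because the inbox after timeslot `k` holds only messages received up to `k`,
each sent strictly before its reception. Inductions on the sending time rely on this. -/
theorem sent_of_mem_inbox {p : Proc} (hp : p ∉ E.faulty) {k : ℕ}
    {x : TMsg ID Base P.Msg} (hx : x ∈ (E.tState p (k + 1)).inbox) :
    ∃ q j, j < k ∧ x ∈ E.tSent q j := by
  obtain ⟨i, hi, hx⟩ := E.received_of_mem_inbox hp hx
  obtain ⟨q, j, hj, hx⟩ := E.received_sent p hp i x hx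
  exact ⟨q, j, by omega, hx⟩

theorem tLog_mono {p : Proc} (hp : p ∉ E.faulty) {j k : ℕ} (hjk : j ≤ k) :
    Log.Extends (E.tState p k).log (E.tState p j).log := by
  induction k, hjk using Nat.le_induction with
  | base => exact List.prefix_refl _
  | succ k _ ih =>
    rcases E.tStep_or_idle hp k with h | h
    · exact ih.trans h.basic.2.2.2.1.extends
    · rwa [h.1]

/-- The state in which the simulation of the process `p` with genesis log `L₀` is at the beginning
of timeslot `k`. -/
noncomputable def simState (L₀ : Log (Transaction ID Base)) (p : Proc) (k : ℕ) : P.State :=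
  simTrace L₀ (E.ids p) (E.tState p) k

theorem simState_eq {p : Proc} (hp : p ∉ E.faulty) {k : ℕ} {σ : Sim P}
    (h : (E.tState p k).sim = some σ) : E.simState σ.genesis p k = σ.st :=
  simTrace_eq (E.tState_zero hp) h

/-- No simulation is started twice with the same genesis log: a new one has a genesis log strictly
beyond the current log, whereas those of all earlier simulations are prefixes of the current log. So
at a fresh start the trace is still in the initial state. -/
theorem simState_of_nextSim {p : Proc} (hp : p ∉ E.faulty) {k : ℕ} {L : Log (Transaction ID Base)}
    {σ : Sim P} (hL : Adopts P S ρ (E.tState p k)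
      ((E.tState p k).inbox ∪ E.tReceived p k) L)
    (h : nextSim P S ρ (E.tState p k) L = some σ) :
    E.simState σ.genesis p k = σ.st := by
  rcases nextSim_eq_some h with h | ⟨rfl, hne, -, -⟩
  · exact E.simState_eq hp h
  · rw [(E.tState_wellFormed hp k).own_eq]
    refine simTrace_of_ne ?_
    rintro j hj τ hτ rfl
    have h1 := ((E.tState_wellFormed hp j).sim τ hτ).1
    have h2 := h1.trans (E.tLog_mono hp hj)
    exact hne (h2.eq_of_length (le_antisymm h2.length_le hL.extends.length_le))

/-- A timeslot of a correct process, as seen by its simulation with genesis log `L₀`. -/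
theorem simState_step {p : Proc} (hp : p ∉ E.faulty) (L₀ : Log (Transaction ID Base)) (k : ℕ) :
    (E.simState L₀ p (k + 1) = E.simState L₀ p k ∧ ∀ id m, TMsg.sim id L₀ m ∉ E.tSent p k) ∨
      ((∃ id ∈ E.ids p, 0 < S.stake L₀ id) ∧ ∃ M X out,
        (E.simState L₀ p (k + 1), out) ∈ P.step (E.simState L₀ p k) M X ∧
        (∀ m ∈ M, ∃ id, 0 < S.stake L₀ id ∧ ∃ q j, j < k ∧ TMsg.sim id L₀ m ∈ E.tSent q j) ∧
        ∀ id m, TMsg.sim id L₀ m ∈ E.tSent p k → m ∈ out) := by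
  have hbasic := E.tStep_or_idle hp k
  rcases hbasic with h | ⟨h1, h2⟩
  · by_cases hσ : ∃ σ, (E.tState p (k + 1)).sim = some σ ∧ σ.genesis = L₀
    · obtain ⟨σ, hσ, rfl⟩ := hσ
      right
      refine ⟨((E.tState_wellFormed hp (k + 1)).sim σ hσ).2.2.2, ?_⟩
      obtain ⟨τ, hτ, hg, M, hM, Y, out, hstep, hout⟩ := h.sim_step hσ
      refine ⟨M, Y, out, ?_, ?_, ?_⟩
      · rw [E.simState_eq hp hσ, hg, E.simState_of_nextSim hp h.basic.2.2.2.1 hτ]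
        exact hstep
      · intro m hm
        obtain ⟨id, hid, hin⟩ := hM hm
        rw [hg]
        exact ⟨id, hid, E.sent_of_mem_inbox hp hin⟩
      · rw [hg]
        exact hout
    · left
      push Not at hσ
      exact ⟨simTrace_succ_of_ne hσ, fun id m hm => by
        obtain ⟨σ', h1, h2⟩ := h.sim_of_sent hm
        exact hσ σ' h1 h2⟩
  · left
    refine ⟨?_, fun id m hm => by rw [h2] at hm; exact hm⟩
    by_cases hσ : ∃ σ, (E.tState p (k + 1)).sim = some σ ∧ σ.genesis = L₀
    · obtain ⟨σ, hσ, rfl⟩ := hσ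
      rw [E.simState_eq hp hσ, E.simState_eq hp (h1 ▸ hσ)]
    · push Not at hσ
      exact simTrace_succ_of_ne hσ

/-- A signature on a log by an identifier of a correct process stems from a simulation of a
correct process. -/
theorem vote_origin {p₀ : Proc} (hp₀ : p₀ ∉ E.faulty) {id : ID} (hid : id ∈ E.ids p₀)
    {L : Log (Transaction ID Base)} (k : ℕ) :
    ∀ q j, j < k → TMsg.vote id L ∈ E.tSent q j →
      ∃ p, p ∉ E.faulty ∧ ∃ i L₀, (∃ id ∈ E.ids p, 0 < S.stake L₀ id) ∧
        Log.Extends (P.log (E.simState L₀ p i)) L ∧ Log.Extends L L₀ ∧ Log.Extends L₀ g ∧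
        LogCompleted S ρ g L₀ ∧ logEpoch S ρ g L = logEpoch S ρ g L₀ + 1 := by
  induction k with
  | zero => intro q j hj; omega
  | succ k ih =>
    intro q j hj hm
    by_cases hq : q ∈ E.faulty
    -- A vote sent by a faulty process is a copy, so it was sent strictly earlier; the same holds
    -- for gossip below. Only a fresh signature ends the descent.
    · obtain ⟨q', -, i, hi, m', hm', hc⟩ :=
        E.unforgeable q hq j _ hm id (TContent.vote L) (Set.mem_singleton _) ⟨p₀, hp₀, hid⟩
      refine ih q' i (by omega) ?_
      rwa [TMsg.eq_vote_of_mem_sigs hc] at hm'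
    · rcases E.tStep_or_idle hq j with h | ⟨-, h⟩
      · rcases h.vote_of_sent hm with h1 | ⟨σ, hσ, h1, h2, h3⟩
        · obtain ⟨q', i, hi, h1⟩ := E.sent_of_mem_inbox hq h1
          exact ih q' i (by omega) h1
        · obtain ⟨-, h4, h5, h6⟩ := (E.tState_wellFormed hq (j + 1)).sim σ hσ
          rw [(E.tState_wellFormed hq j).genesis_eq] at h3
          refine ⟨q, hq, j + 1, σ.genesis, h6, ?_, h2, h4, h5, h3⟩
          rwa [E.simState_eq hq hσ]
      · rw [h] at hm
        exact absurd hm (Set.notMem_empty _)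

theorem stakeOf_mono {ID Tx : Type} (S : StakeFunction ID Tx) (L : Log Tx) {A B : Set ID}
    (h : A ⊆ B) : S.stakeOf L A ≤ S.stakeOf L B := by
  classical
  unfold StakeFunction.stakeOf
  refine Finset.sum_le_sum_of_subset_of_nonneg ?_ fun _ _ _ => NNReal.coe_nonneg _
  intro id hid
  simp only [Finset.mem_filter] at hid ⊢
  exact ⟨hid.1, h hid.2⟩

/-- The simulations with genesis log `L₀` are consistent. -/
theorem simState_consistent (hΔ : 0 < Δ) (hP : PermissionedConsistent P S ρ Δ)
    {L₀ : Log (Transaction ID Base)} (hheld : ∀ id, 0 < S.stake L₀ id → ∃ p, id ∈ E.ids p)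
    (hbound : S.stakeOf L₀ E.faultyIds ≤ ρ * S.total)
    {p q : Proc} (hp : p ∉ E.faulty) (hq : q ∉ E.faulty)
    (hp' : ∃ id ∈ E.ids p, 0 < S.stake L₀ id) (hq' : ∃ id ∈ E.ids q, 0 < S.stake L₀ id)
    (k₁ k₂ : ℕ) :
    Log.Consistent (P.log (E.simState L₀ p k₁)) (P.log (E.simState L₀ q k₂)) := by
  classical
  let Q : Type := {p : Proc // ∃ id ∈ E.ids p, 0 < S.stake L₀ id}
  let faulty : Set Q := {p | p.1 ∈ E.faulty}
  have hstep : ∀ (p : Q) (k : ℕ), p ∉ faulty → ∃ M out : Set P.Msg,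
      ((E.simState L₀ p.1 (k + 1) = E.simState L₀ p.1 k ∧ out = ∅ ∧ M = ∅) ∨
        ∃ X, (E.simState L₀ p.1 (k + 1), out) ∈ P.step (E.simState L₀ p.1 k) M X) ∧
      (∀ m ∈ M, ∃ id, 0 < S.stake L₀ id ∧ ∃ q j, j < k ∧ TMsg.sim id L₀ m ∈ E.tSent q j) ∧
      ∀ id m, TMsg.sim id L₀ m ∈ E.tSent p.1 k → m ∈ out := by
    intro p k hp
    rcases E.simState_step hp L₀ k with ⟨h1, h2⟩ | ⟨-, M, X, out, h1, h2, h3⟩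
    · exact ⟨∅, ∅, Or.inl ⟨h1, rfl, rfl⟩, by simp, fun id m hm => absurd hm (h2 id m)⟩
    · exact ⟨M, out, Or.inr ⟨X, h1⟩, h2, h3⟩
  choose! M out hstep hM hout using hstep
  -- A faulty process may use identifiers of other faulty processes, or hold no stake in `L₀` and
  -- thus lie outside `Q`. A message sent by any faulty process is therefore attributed to the
  -- holder of the identifier that signs it.
  let sent : Q → ℕ → Set P.Msg := fun p k =>
    if p ∈ faulty then
      {m | ∃ id ∈ E.ids p.1, ∃ q, q ∈ E.faulty ∧ TMsg.sim id L₀ m ∈ E.tSent q k}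
    else out p k
  -- A correct sender of such a message is running the simulation, hence holds stake in `L₀` and
  -- belongs to `Q`.
  have hcorrect : ∀ q, q ∉ E.faulty → ∀ j id m, TMsg.sim id L₀ m ∈ E.tSent q j →
      ∃ q' : Q, q' ∉ faulty ∧ m ∈ sent q' j := by
    intro q hq j id m hm
    rcases E.simState_step hq L₀ j with ⟨-, h2⟩ | ⟨h1, -⟩
    · exact absurd hm (h2 id m)
    · have hq' : (⟨q, h1⟩ : Q) ∉ faulty := hq
      exact ⟨⟨q, h1⟩, hq', by simpa only [sent, if_neg hq'] using hout ⟨q, h1⟩ j hq' id m hm⟩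
  obtain ⟨E', hids, hfaulty, hact, hstate⟩ := Execution.exists_of_partial P L₀ hΔ
    (fun p : Q => E.ids p.1)
    (fun p q id h1 h2 => Subtype.ext (E.ids_disjoint p.1 q.1 id h1 h2))
    faulty (max k₁ k₂) (fun p k => E.simState L₀ p.1 k) M sent
    (fun p hp => rfl)
    (fun p hp k hk => by simpa only [sent, if_neg hp] using hstep p k hp)
    (by
      intro p hp k hk m hm
      obtain ⟨id, hid, q, j, hj, hs⟩ := hM p k hp m hm
      -- If the sender is faulty, the holder `r` of the signing identifier decides: a faulty `r` is
      -- the sender by the definition of `sent`, and for a correct `r` the message is a copy of an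
      -- earlier one from a correct process.
      by_cases hq : q ∈ E.faulty
      · obtain ⟨r, hr⟩ := hheld id hid
        by_cases hrf : r ∈ E.faulty
        · have hr' : (⟨r, id, hr, hid⟩ : Q) ∈ faulty := hrf
          refine ⟨⟨r, id, hr, hid⟩, j, hj, ?_⟩
          simp only [sent, if_pos hr']
          exact ⟨id, hr, q, hq, hs⟩
        · obtain ⟨q', hq', i, hi, m', hm', hc⟩ :=
            E.unforgeable q hq j _ hs id (TContent.simMsg L₀ m)
              (Set.mem_union_left _ (Set.mem_singleton _)) ⟨r, hrf, hr⟩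
          rw [TMsg.eq_sim_of_mem_sigs hc] at hm'
          obtain ⟨q'', -, hs'⟩ := hcorrect q' hq' i id m hm'
          exact ⟨q'', i, hi.trans hj, hs'⟩
      · obtain ⟨q', -, hs'⟩ := hcorrect q hq j id m hs
        exact ⟨q', j, hj, hs'⟩)
    (by
      intro f hf j hj m hm id c hc hpc
      obtain ⟨r, hr, hidr⟩ := hpc
      simp only [sent, if_pos hf] at hm
      obtain ⟨id', -, q, hq, hs⟩ := hm
      obtain ⟨q', hq', i, hi, m', hm', hc'⟩ :=
        E.unforgeable q hq j _ hs id (TContent.simInner L₀ c)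
          (Set.mem_union_right _ ⟨id, c, hc, rfl⟩) ⟨r.1, hr, hidr⟩
      obtain ⟨id'', m'', rfl, hc''⟩ := TMsg.exists_of_simInner_mem_sigs hc'
      obtain ⟨q'', hq'', hs'⟩ := hcorrect q' hq' i id'' m'' hm'
      exact ⟨q'', hq'', i, hi, m'', hs', hc''⟩)
  have hfids : E'.faultyIds ⊆ E.faultyIds := by
    rintro id ⟨r, hr, hid⟩
    rw [hfaulty] at hr
    rw [hids] at hid
    exact ⟨r.1, hr, hid⟩
  obtain ⟨hroll, hdiv⟩ := hP Q L₀ E'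
    ⟨fun r => by rw [hids]; exact r.2,
      fun id hid => by
        obtain ⟨r, hr⟩ := hheld id hid
        rw [hids]
        exact ⟨⟨r, id, hr, hid⟩, hr⟩,
      hact⟩
    ((stakeOf_mono S L₀ hfids).trans hbound)
  have hlog : ∀ (r : Q) k, k ≤ max k₁ k₂ → E'.log r k = P.log (E.simState L₀ r.1 k) :=
    fun r k hk => by rw [Execution.log, hstate r k hk]
  have hmono : ∀ r : Q, r.1 ∉ E.faulty → ∀ k ≤ max k₁ k₂,
      Log.Extends (P.log (E.simState L₀ r.1 (max k₁ k₂))) (P.log (E.simState L₀ r.1 k)) := by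
    intro r hr k hk
    rw [← hlog r k hk, ← hlog r _ le_rfl]
    rcases hk.lt_or_eq with h | h
    · exact hroll r (by rw [hfaulty]; exact hr) _ _ h
    · rw [h]; exact List.prefix_refl _
  -- Absence of rollback carries both logs to the common time `max k₁ k₂`, where they do not
  -- diverge; two prefixes of one log are comparable.
  have h1 := hmono ⟨p, hp'⟩ hp k₁ (le_max_left _ _)
  have h2 := hmono ⟨q, hq'⟩ hq k₂ (le_max_right _ _)
  have h3 := hdiv ⟨p, hp'⟩ (by rw [hfaulty]; exact hp) ⟨q, hq'⟩ (by rw [hfaulty]; exact hq)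
    (max k₁ k₂)
  rw [hlog _ _ le_rfl, hlog _ _ le_rfl] at h3
  rcases h3 with h3 | h3
  · exact (List.prefix_or_prefix_of_prefix h1 (h2.trans h3)).symm
  · exact (List.prefix_or_prefix_of_prefix (h1.trans h3) h2).symm

end Execution

end Executions

/-! ## Consistency of certified logs -/

section Consistency

variable {ID Base : Type} {S : StakeFunction ID (Transaction ID Base)} {ρ : ℝ}
  {g : Log (Transaction ID Base)}

/-- A set of identifiers with more stake than the identifiers in `A` has a member with positive
stake outside `A`. -/
theorem StakeFunction.exists_notMem_of_stakeOf_lt {ID Tx : Type} (S : StakeFunction ID Tx)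
    (L : Log Tx) (A : Set ID) (I : Finset ID)
    (h : S.stakeOf L A < ∑ id ∈ I, (S.stake L id : ℝ)) :
    ∃ id ∈ I, id ∉ A ∧ 0 < S.stake L id := by
  classical
  by_contra! hc
  refine h.not_ge ?_
  rw [← Finset.sum_filter_ne_zero, StakeFunction.stakeOf]
  refine Finset.sum_le_sum_of_subset_of_nonneg ?_ fun _ _ _ => NNReal.coe_nonneg _
  intro id hid
  simp only [Finset.mem_filter, NNReal.coe_ne_zero] at hid ⊢
  have hpos := pos_iff_ne_zero.2 hid.2
  exact ⟨(S.mem_currentIds L id).2 hpos, by_contra fun hA => (hc id hid.1 hA).not_gt hpos⟩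

/-- A fully certified log of epoch more than `e` has a certified prefix of epoch `e + 1` that is
the whole log or an epoch prefix. -/
theorem FullyCertified.exists_prefix {V : Set (ID × Log (Transaction ID Base))}
    {L L₀ : Log (Transaction ID Base)} {e : ℕ} (hL : FullyCertified S ρ g V L)
    (h₀ : IsEpochPrefix S ρ g L e L₀) :
    ∃ M, Certified S ρ g V M ∧ logEpoch S ρ g M = e + 1 ∧ IsEpochPrefix S ρ g M e L₀ ∧
      (M = L ∨ IsEpochPrefix S ρ g L (e + 1) M) := by
  obtain ⟨h1, h2, h3, h4, h5⟩ := h₀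
  rcases (Nat.succ_le_of_lt h1).lt_or_eq with h | h
  · obtain ⟨M, hM⟩ := exists_isEpochPrefix S ρ g L hL.1.extends (e + 1) h
    refine ⟨M, hL.2 _ _ hM, hM.2.2.2.1, ⟨?_, ?_, h3, h4, h5⟩, Or.inr hM⟩
    · rw [hM.2.2.2.1]; omega
    · rcases List.prefix_or_prefix_of_prefix h2 hM.2.1 with h6 | h6
      · exact h6
      · have := logEpoch_mono S ρ g M L₀ hM.2.2.1 h6
        rw [hM.2.2.2.1, h4] at this
        omega
  · exact ⟨L, hL.1, h.symm, ⟨h1, h2, h3, h4, h5⟩, Or.inl rfl⟩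

theorem eq_genesis_of_logEpoch_eq_zero {L : Log (Transaction ID Base)} (h : Log.Extends L g)
    (h0 : logEpoch S ρ g L = 0) : L = g := by
  by_contra hne
  have := logEpoch_lt S ρ g g L (List.prefix_refl _) h (Ne.symm hne) (logCompleted_genesis S ρ g)
  omega

/-- A completed log ends its epoch: every strict extension belongs to a later one. -/
theorem eq_of_consistent_of_completed {L₁ L₂ : Log (Transaction ID Base)}
    (h₁ : Log.Extends L₁ g) (h₂ : Log.Extends L₂ g) (h : Log.Consistent L₁ L₂)
    (hc₁ : LogCompleted S ρ g L₁) (hc₂ : LogCompleted S ρ g L₂)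
    (he : logEpoch S ρ g L₁ = logEpoch S ρ g L₂) : L₁ = L₂ := by
  by_contra hne
  rcases h with h | h
  · exact (logEpoch_lt S ρ g L₂ L₁ h₂ h (Ne.symm hne) hc₂).ne' he
  · exact (logEpoch_lt S ρ g L₁ L₂ h₁ h hne hc₁).ne he

namespace Execution

variable {Proc : Type} {ℓ Δ : ℕ} {P : Protocol ID (Transaction ID Base)}
  (E : Execution (transform P S ρ ℓ Δ) g Δ Proc)

/-- A log that is certified at a correct process has been obtained from a simulation of a correct
process. -/
theorem exists_sim_of_certified (hρ : ρ < 1 / 2) {p : Proc} (hp : p ∉ E.faulty) {k e : ℕ}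
    {L₀ M : Log (Transaction ID Base)} (hheld : ∀ id, 0 < S.stake L₀ id → ∃ p, id ∈ E.ids p)
    (hbound : S.stakeOf L₀ E.faultyIds ≤ ρ * S.total)
    (hcert : Certified S ρ g (votesIn (E.tState p k).inbox) M) (he : logEpoch S ρ g M = e + 1)
    (h₀ : IsEpochPrefix S ρ g M e L₀) :
    ∃ q, q ∉ E.faulty ∧ (∃ id ∈ E.ids q, 0 < S.stake L₀ id) ∧
      ∃ i, Log.Extends (P.log (E.simState L₀ q i)) M := by
  have hne : M ≠ g := by
    rintro rfl
    rw [logEpoch_genesis] at he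
    omega
  rcases hcert with h | ⟨hMg, I, -, hI, hstake⟩
  · exact absurd h hne
  have hprev := logPrev_isEpochPrefix S ρ g M hMg hne
  rw [he, Nat.add_sub_cancel] at hprev
  -- The certifying stake is measured in `logPrev`, which is `L₀`, the log in which the faulty stake
  -- is bounded.
  rw [isEpochPrefix_unique S ρ g M e _ _ hprev h₀] at hstake
  have hT : (0 : ℝ) < S.total := S.total_pos
  -- The quorum outweighs the faulty stake since `ρ < 1 - ρ`.
  obtain ⟨id, hid, hf, hpos⟩ := S.exists_notMem_of_stakeOf_lt L₀ E.faultyIds I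
    (lt_of_lt_of_le (hbound.trans_lt (mul_lt_mul_of_pos_right (by linarith) hT)) hstake)
  obtain ⟨r, hr⟩ := hheld id hpos
  have hrf : r ∉ E.faulty := fun h => hf ⟨r, h, hr⟩
  obtain ⟨j, -, hrec⟩ := E.received_of_mem_inbox hp (hI id hid)
  obtain ⟨s, j', -, hs⟩ := E.received_sent p hp j _ hrec
  obtain ⟨q, hq, i, L₁, hst, h1, h2, h3, h4, h5⟩ :=
    E.vote_origin (L := M) hrf hr (j' + 1) s j' (by omega) hs
  -- The signature does not name the simulation it comes from, but the genesis log of that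
  -- simulation is the epoch prefix of `M` for `e`.
  have : L₁ = L₀ := isEpochPrefix_unique S ρ g M e _ _
    ⟨by omega, h2, h3, by omega, h4⟩ h₀
  subst this
  exact ⟨q, hq, hst, i, h1⟩

theorem extends_genesis {p : Proc} (hp : p ∉ E.faulty) (k : ℕ) : Log.Extends (E.log p k) g :=
  (E.tState_wellFormed hp k).certified.1.extends

/-- The logs of two correct processes are consistent at all times. -/
theorem log_consistent (hρ : ρ < 1 / 2) (hΔ : 0 < Δ) (hP : PermissionedConsistent P S ρ Δ)
    (hE : E.QuasiPermissionless S) (hadv : E.QuasiPermissionlessBounded S ρ)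
    {p q : Proc} (hp : p ∉ E.faulty) (hq : q ∉ E.faulty) (k₁ k₂ : ℕ) :
    Log.Consistent (E.log p k₁) (E.log q k₂) := by
  by_contra hcon
  have key : ∀ e, ∃ L₀, IsEpochPrefix S ρ g (E.log p k₁) e L₀ ∧
      IsEpochPrefix S ρ g (E.log q k₂) e L₀ := by
    intro e
    induction e with
    | zero =>
      have hg : ∀ L, Log.Extends L g → L ≠ g → IsEpochPrefix S ρ g L 0 g := fun L hL hne =>
        ⟨Nat.pos_of_ne_zero fun h => hne (eq_genesis_of_logEpoch_eq_zero hL h), hL,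
          List.prefix_refl _, logEpoch_genesis S ρ g, logCompleted_genesis S ρ g⟩
      refine ⟨g, hg _ (E.extends_genesis hp k₁) fun h => hcon (Or.inr ?_),
        hg _ (E.extends_genesis hq k₂) fun h => hcon (Or.inl ?_)⟩
      · rw [h]; exact E.extends_genesis hq k₂
      · rw [h]; exact E.extends_genesis hp k₁
    | succ e ih =>
      obtain ⟨L₀, h₁, h₂⟩ := ih
      obtain ⟨M₁, c₁, e₁, p₁, d₁⟩ := (E.tState_wellFormed hp k₁).certified.exists_prefix h₁
      obtain ⟨M₂, c₂, e₂, p₂, d₂⟩ := (E.tState_wellFormed hq k₂).certified.exists_prefix h₂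
      -- `L₀` lies between `g` and the log of a correct process, which is where the
      -- quasi-permissionless assumptions apply.
      have hheld := hE.held p hp k₁ L₀ h₁.2.1 h₁.2.2.1
      have hbound := hadv p hp k₁ L₀ h₁.2.1 h₁.2.2.1
      obtain ⟨r₁, hr₁, hs₁, i₁, hx₁⟩ := E.exists_sim_of_certified hρ hp hheld hbound c₁ e₁ p₁
      obtain ⟨r₂, hr₂, hs₂, i₂, hx₂⟩ := E.exists_sim_of_certified hρ hq hheld hbound c₂ e₂ p₂
      have hM : Log.Consistent M₁ M₂ := by
        rcases E.simState_consistent hΔ hP hheld hbound hr₁ hr₂ hs₁ hs₂ i₁ i₂ with h | h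
        · exact (List.prefix_or_prefix_of_prefix hx₁ (hx₂.trans h)).symm
        · exact (List.prefix_or_prefix_of_prefix (hx₁.trans h) hx₂).symm
      have hlt : ∀ {M M' L}, IsEpochPrefix S ρ g L (e + 1) M → logEpoch S ρ g M' = e + 1 →
          Log.Extends M' M → M' = M := by
        intro M M' L hM he hx
        by_contra hne
        have := logEpoch_lt S ρ g M M' hM.2.2.1 hx (Ne.symm hne) hM.2.2.2.2
        rw [hM.2.2.2.1] at this
        omega
      -- If one of `M₁`, `M₂` is a whole log, their consistency makes the two logs consistent: by
      -- `hlt` a whole log of epoch `e + 1` cannot go strictly beyond a completed log of that epoch.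
      -- So both are completed and hence equal.
      rcases d₁ with rfl | d₁ <;> rcases d₂ with rfl | d₂
      · exact absurd hM hcon
      · refine absurd ?_ hcon
        rcases hM with h | h
        · have h' : E.log p k₁ = M₂ := hlt d₂ e₁ h
          exact Or.inr (h' ▸ d₂.2.1)
        · exact Or.inr (h.trans d₂.2.1)
      · refine absurd ?_ hcon
        rcases hM with h | h
        · exact Or.inl (h.trans d₁.2.1)
        · have h' : E.log q k₂ = M₁ := hlt d₁ e₂ h
          exact Or.inl (h' ▸ d₁.2.1)
      · have : M₁ = M₂ := eq_of_consistent_of_completed c₁.extends c₂.extends hM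
          d₁.2.2.2.2 d₂.2.2.2.2 (e₁.trans e₂.symm)
        exact ⟨M₁, d₁, this ▸ d₂⟩
  -- No log has an epoch prefix for its own epoch.
  obtain ⟨L₀, h, -⟩ := key (logEpoch S ρ g (E.log p k₁))
  exact absurd h.1 (lt_irrefl _)

end Execution

end Consistency

theorem mainTheorem1 {ID Base : Type} (S : StakeFunction ID (Transaction ID Base))
    (ρ : ℝ) (hρ0 : 0 ≤ ρ) (hρ : ρ < 1 / 2) (ℓ Δ : ℕ) (hΔ : 0 < Δ)
    (P : Protocol ID (Transaction ID Base)) (hP : PermissionedConsistent P S ρ Δ)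
    (Proc : Type) (g : Log (Transaction ID Base))
    (E : Execution (transform P S ρ ℓ Δ) g Δ Proc)
    (hE : E.QuasiPermissionless S) (hadv : E.QuasiPermissionlessBounded S ρ) :
    E.NoRollback ∧ E.NoDivergence ∧
      ∀ p, p ∉ E.faulty → ∀ q, q ∉ E.faulty → ∀ k₁ k₂,
        LogCompleted S ρ g (E.log p k₁) → LogCompleted S ρ g (E.log q k₂) →
        logEpoch S ρ g (E.log p k₁) = logEpoch S ρ g (E.log q k₂) →
        E.log p k₁ = E.log q k₂ := by
  exact ⟨fun p hp k₁ k₂ hk => E.tLog_mono hp hk.le,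
    fun p hp q hq k => E.log_consistent hρ hΔ hP hE hadv hp hq k k,
    fun p hp q hq k₁ k₂ h₁ h₂ he => eq_of_consistent_of_completed (E.extends_genesis hp k₁)
      (E.extends_genesis hq k₂) (E.log_consistent hρ hΔ hP hE hadv hp hq k₁ k₂) h₁ h₂ he⟩
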